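/- Consider the following deterministic online algorithm for unweighted interval selection with revoking. An instance is a finite family $\mathcal I$ of intervals $[s,f)$, $s<f$, on the real line (repetitions allowed, with any number $k$ of distinct lengths); two intervals conflict if they intersect, and a set of intervals is feasible if no two of its members conflict. The intervals arrive one at a time. If the arriving interval $I$ conflicts with no currently held interval, it is taken. Otherwise, if $I$ is strictly contained in a currently held interval $I'$, then $I$ is taken and $I'$ is discarded for good (replaced). Otherwise $I$ is discarded for good. Let $\mathrm{OPT}$ be the maximum size of a feasible subset of $\mathcal I$ and $\mathrm{ALG}$ the size of the algorithm's final solution, and let the arrival order be a uniformly random permutation of $\mathcal I$. Then: 1. The algorithm is $2.5$-competitive: for every instance, $\mathrm{OPT}\le 2.5\cdot\mathbb E[\mathrm{ALG}]$. 2. For each interval $J$ of the final solution, its predecessor trace is the maximal list $(P_1,\dots,P_d=J)$ in which each $P_{j+1}$ replaced $P_j$. Number the final intervals $J_1,\dots,J_{\mathrm{ALG}}$ in the order in which the first elements of their traces were taken. Fix an optimal solution $O$ of the instance. Charge each member of $O$, on its arrival, to itself if it is taken, and otherwise to one, arbitrarily chosen, of the held intervals that it conflicts with; when an interval is replaced,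 all of its charge passes to the interval that replaces it. Let $\Phi(J_i)$ be the number of members of $O$ that are finally charged to $J_i$. Then, for every $i$ with $\Pr[\mathrm{ALG}\ge i]>0$, $$\mathbb E\big[\Phi(J_i)\;\big|\;\mathrm{ALG}\ge i\big]\le 2.5 .$$ -/

import Mathlib

open scoped BigOperators

/-- An interval on the real line, with starting point strictly before its end point. -/
structure RealInterval where
  start : ℝ
  finish : ℝ
  start_lt_finish : start < finish

namespace RealInterval

/-- The space `[start, finish)` occupied by an interval. -/
def toSet (I : RealInterval) : Set ℝ := Set.Ico I.start I.finish

/-- Two intervals conflict if they intersect (partially, or by containment). -/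
def Conflict (I J : RealInterval) : Prop := (I.toSet ∩ J.toSet).Nonempty

/-- `I` is strictly contained in `J`. -/
def Subsumed (I J : RealInterval) : Prop := I.toSet ⊂ J.toSet

end RealInterval

namespace IntervalSelection

open RealInterval

/-- An instance is a finite family of `n` intervals; repetitions are allowed, and items are
identified with their indices. A set of items is feasible if no two of its members conflict. -/
def Feasible {n : ℕ} (inst : Fin n → RealInterval) (O : Finset (Fin n)) : Prop :=
  ∀ x ∈ O, ∀ y ∈ O, x ≠ y → ¬ Conflict (inst x) (inst y)

/-- A feasible set of maximum cardinality. -/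
def IsOptimal {n : ℕ} (inst : Fin n → RealInterval) (O : Finset (Fin n)) : Prop :=
  Feasible inst O ∧ ∀ O' : Finset (Fin n), Feasible inst O' → O'.card ≤ O.card

open Classical in
/-- The size of an optimal solution. -/
noncomputable def optSize {n : ℕ} (inst : Fin n → RealInterval) : ℕ :=
  (Finset.univ.filter (fun O : Finset (Fin n) => Feasible inst O)).sup Finset.card

open Classical in
/-- One step of the greedy revoking algorithm, on the arrival of the item `x` when the current
solution is `H`. If `x` conflicts with nothing, it is taken, and it is put at the end of the list.
Otherwise, if `x` is strictly contained in a conflicting held item, it takes that item's place in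
the list. Otherwise it is discarded.

Thus each place of the list holds, over time, exactly the successive members of one predecessor
trace, and the places are numbered in the order in which the traces were started. -/
noncomputable def step {n : ℕ} (inst : Fin n → RealInterval) (H : List (Fin n)) (x : Fin n) :
    List (Fin n) :=
  if ∀ y ∈ H, ¬ Conflict (inst x) (inst y) then H ++ [x]
  else
    match H.findIdx? (fun y =>
        decide (Conflict (inst x) (inst y) ∧ Subsumed (inst x) (inst y))) with
    | some i => H.set i x
    | none => H

/-- The solution held after the first `t` arrivals, when the item arriving at time
`s = 0, 1, …, n - 1` is `σ s`. -/
noncomputable def solutionAt {n : ℕ} (inst : Fin n → RealInterval) (σ : Equiv.Perm (Fin n))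
    (t : ℕ) : List (Fin n) :=
  ((List.ofFn σ).take t).foldl (step inst) []

/-- The final solution of the algorithm on the arrival order `σ`. -/
noncomputable def algSolution {n : ℕ} (inst : Fin n → RealInterval) (σ : Equiv.Perm (Fin n)) :
    List (Fin n) :=
  solutionAt inst σ n

/-- `F` is a legal charging of the items of `O` to the predecessor traces (numbered as the places
of the solution list) on the arrival order `σ`. An item of `O` that is taken on its arrival is
charged to itself; an item of `O` that is rejected on its arrival is charged to one, arbitrarily
chosen, of the held items that it conflicts with. Since a replacing item inherits the place of the
replaced one, charges are transferred to the replacing item. -/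
def IsCharging {n : ℕ} (inst : Fin n → RealInterval) (O : Finset (Fin n))
    (σ : Equiv.Perm (Fin n)) (F : Fin n → ℕ) : Prop :=
  ∀ t : Fin n, σ t ∈ O →
    (σ t ∈ solutionAt inst σ (t + 1) →
      (solutionAt inst σ (t + 1))[F (σ t)]? = some (σ t)) ∧
    (σ t ∉ solutionAt inst σ (t + 1) →
      ∃ y, (solutionAt inst σ t)[F (σ t)]? = some y ∧ Conflict (inst (σ t)) (inst y))

/-- The total charge of the final interval in place `i`, accumulated over its whole predecessor
trace. -/
def charge {n : ℕ} (O : Finset (Fin n)) (F : Fin n → ℕ) (i : ℕ) : ℕ :=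
  (O.filter (fun o => F o = i)).card

end IntervalSelection

/-! Held intervals are pairwise compatible, so a predecessor trace sees later arrivals only through
its current last interval `y`: an arrival strictly inside `y` replaces it, and any other leaves it
alone. The places of the solution list can thus be analysed one at a time. The arbitrary choice of
charges is relaxed by counting a member of `O` at every place whose holder it meets.

The core is `meanTraceCharge_le`: if `y` holds a place and the items of `A` are still to come in
random order, the place collects at most 5/2 in expectation. The induction is on the size of `A`, by
conditioning on the first arrival. Let `m` members of `O` in `A` lie strictly inside `y`, and let
`r` others meet `y`; geometry gives `r ≤ 2`. An inner arrival is charged 1 and then blocks every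
further charge, a saving of 3/2. An outer one is charged 1 and leaves at most `r + m - 1` to come.
Any other arrival is covered by induction. All arrivals being equally likely, the savings outweigh
the excess once `r + m ≥ 3`; otherwise the bound is trivial.

When a place is opened, the remaining order is still uniform, and an opener from `O` blocks further
charges. Hence `expect_placeCharge_le`: the expected charge of place `i` is at most 5/2 times the
probability that it is opened. Dividing gives the conditional bound. Summing over places gives the
competitive ratio, since every member of `O` meets some held interval just after its arrival. -/

open scoped Nat

namespace IntervalSelection

open RealInterval

/-! ### Uniformly random orders and their first item. -/

section Orders

variable {α : Type*} [DecidableEq α]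

/-- The arrival orders of a finite set of items: the lists enumerating it without repetition. -/
noncomputable def orders (A : Finset α) : Finset (List α) := A.toList.permutations.toFinset

theorem mem_orders {A : Finset α} {l : List α} :
    l ∈ orders A ↔ l.Nodup ∧ ∀ x, x ∈ l ↔ x ∈ A := by
  rw [orders, List.mem_toFinset, List.mem_permutations]
  constructor
  · intro h
    exact ⟨h.symm.nodup A.nodup_toList, fun x => by rw [h.mem_iff, Finset.mem_toList]⟩
  · rintro ⟨h, h'⟩
    exact (List.perm_ext_iff_of_nodup h A.nodup_toList).2 fun x => by rw [h', Finset.mem_toList]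

theorem card_orders (A : Finset α) : (orders A).card = A.card ! := by
  rw [orders, List.toFinset_card_of_nodup (List.nodup_permutations _ A.nodup_toList),
    List.length_permutations, Finset.length_toList]

theorem orders_nonempty (A : Finset α) : (orders A).Nonempty := by
  rw [← Finset.card_pos, card_orders]
  exact Nat.factorial_pos _

theorem orders_empty : orders (∅ : Finset α) = {[]} := by
  ext l
  rw [mem_orders, Finset.mem_singleton]
  constructor
  · rintro ⟨-, h⟩
    exact List.eq_nil_iff_forall_not_mem.2 fun x hx => by simpa using (h x).1 hx
  · rintro rfl
    simp

theorem sum_orders {A : Finset α} (hA : A.Nonempty) (g : List α → ℝ) :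
    ∑ l ∈ orders A, g l = ∑ x ∈ A, ∑ l ∈ orders (A.erase x), g (x :: l) := by
  obtain ⟨a, -⟩ := id hA
  rw [Finset.sum_sigma']
  refine Finset.sum_bij' (fun l _ => ⟨l.headD a, l.tail⟩) (fun p _ => p.1 :: p.2) ?_ ?_ ?_ ?_ ?_
  · rintro (_ | ⟨x, l⟩) hl
    · obtain ⟨b, hb⟩ := hA
      simpa using ((mem_orders.1 hl).2 b).2 hb
    · obtain ⟨h1, h2⟩ := mem_orders.1 hl
      rw [List.nodup_cons] at h1
      refine Finset.mem_sigma.2 ⟨(h2 x).1 (by simp), mem_orders.2 ⟨h1.2, fun y => ?_⟩⟩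
      have hy := h2 y
      simp only [List.mem_cons] at hy
      simp only [List.tail_cons, List.headD_cons, Finset.mem_erase]
      rw [← hy]
      constructor
      · intro h
        exact ⟨by rintro rfl; exact h1.1 h, Or.inr h⟩
      · rintro ⟨h, h'⟩
        exact h'.resolve_left h
  · rintro ⟨x, l⟩ hp
    obtain ⟨hx, hl⟩ := Finset.mem_sigma.1 hp
    obtain ⟨h1, h2⟩ := mem_orders.1 hl
    refine mem_orders.2 ⟨List.nodup_cons.2 ⟨?_, h1⟩, fun y => ?_⟩
    · intro h
      simpa using (h2 x).1 h
    · dsimp only at hx h2 ⊢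
      rw [List.mem_cons, h2, Finset.mem_erase]
      by_cases h : y = x
      · simp [h, hx]
      · simp [h]
  · rintro (_ | ⟨x, l⟩) hl
    · obtain ⟨b, hb⟩ := hA
      simpa using ((mem_orders.1 hl).2 b).2 hb
    · rfl
  · rintro ⟨x, l⟩ -
    rfl
  · rintro (_ | ⟨x, l⟩) hl
    · obtain ⟨b, hb⟩ := hA
      simpa using ((mem_orders.1 hl).2 b).2 hb
    · rfl

/-- The first item of a uniformly random order is uniformly random, and the order of the others
is then again uniformly random. -/
theorem expect_orders {A : Finset α} (hA : A.Nonempty) (g : List α → ℝ) :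
    𝔼 l ∈ orders A, g l = 𝔼 x ∈ A, 𝔼 l ∈ orders (A.erase x), g (x :: l) := by
  -- All inner averages share the denominator `(A.card - 1)!`, so their average is the overall
  -- average.
  have hc : ∀ x ∈ A, 𝔼 l ∈ orders (A.erase x), g (x :: l) =
      (∑ l ∈ orders (A.erase x), g (x :: l)) / ((A.card - 1)! : ℕ) := fun x hx => by
    rw [Finset.expect_eq_sum_div_card, card_orders, Finset.card_erase_of_mem hx]
  rw [Finset.expect_congr rfl hc, Finset.expect_eq_sum_div_card, Finset.expect_eq_sum_div_card,
    card_orders, sum_orders hA, ← Finset.sum_div, div_div,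
    ← Nat.mul_factorial_pred (Finset.card_pos.2 hA).ne', Nat.cast_mul, mul_comm (A.card : ℝ)]

theorem expect_perm {n : ℕ} (g : List (Fin n) → ℝ) :
    𝔼 σ : Equiv.Perm (Fin n), g (List.ofFn σ) = 𝔼 l ∈ orders (Finset.univ : Finset (Fin n)), g l := by
  have hinj : Function.Injective fun σ : Equiv.Perm (Fin n) => List.ofFn σ :=
    fun σ τ h => Equiv.coe_fn_injective (List.ofFn_injective h)
  have him : Finset.univ.image (fun σ : Equiv.Perm (Fin n) => List.ofFn σ) =
      orders (Finset.univ : Finset (Fin n)) := by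
    refine Finset.eq_of_subset_of_card_le ?_ ?_
    · intro l hl
      obtain ⟨σ, -, rfl⟩ := Finset.mem_image.1 hl
      refine mem_orders.2 ⟨List.nodup_ofFn.2 σ.injective, fun x => ?_⟩
      simpa [List.mem_ofFn] using σ.surjective x
    · rw [card_orders, Finset.card_image_of_injective _ hinj, Finset.card_univ, Finset.card_univ,
        Fintype.card_perm]
  rw [← him, Finset.expect_image hinj.injOn]

end Orders

/-! ### Dynamics of the algorithm. -/

section Step

variable {n : ℕ} {inst : Fin n → RealInterval}

theorem _root_.RealInterval.conflict_self (I : RealInterval) : Conflict I I :=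
  ⟨I.start, ⟨le_rfl, I.start_lt_finish⟩, le_rfl, I.start_lt_finish⟩

theorem _root_.RealInterval.Conflict.symm {I J : RealInterval} (h : Conflict I J) :
    Conflict J I := by
  obtain ⟨x, hI, hJ⟩ := h
  exact ⟨x, hJ, hI⟩

theorem _root_.RealInterval.Conflict.mono {I J K : RealInterval} (h : Conflict I J)
    (hJK : Subsumed J K) : Conflict I K := by
  obtain ⟨x, hI, hJ⟩ := h
  exact ⟨x, hI, hJK.subset hJ⟩

theorem _root_.RealInterval.Subsumed.conflict {I J : RealInterval} (h : Subsumed I J) :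
    Conflict I J := (conflict_self I).mono h

/-- The three cases of a step: a new place is opened, an item is replaced, or the new item is
discarded. -/
theorem step_cases (inst : Fin n → RealInterval) (H : List (Fin n)) (x : Fin n) :
    (step inst H x = H ++ [x] ∧ ∀ y ∈ H, ¬ Conflict (inst x) (inst y)) ∨
    (∃ (j : ℕ) (hj : j < H.length), step inst H x = H.set j x ∧
      Subsumed (inst x) (inst H[j])) ∨
    (step inst H x = H ∧ (∃ y ∈ H, Conflict (inst x) (inst y)) ∧
      ∀ y ∈ H, ¬ Subsumed (inst x) (inst y)) := by
  classical
  unfold step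
  split_ifs with h
  · exact Or.inl ⟨rfl, h⟩
  · right
    push Not at h
    split
    next j hj =>
      left
      obtain ⟨hj', hp, -⟩ := List.findIdx?_eq_some_iff_getElem.1 hj
      exact ⟨j, hj', rfl, (of_decide_eq_true hp).2⟩
    next hnone =>
      right
      rw [List.findIdx?_eq_none_iff] at hnone
      exact ⟨rfl, h, fun y hy hs => of_decide_eq_false (hnone y hy) ⟨hs.conflict, hs⟩⟩

/-- The held items are pairwise compatible. -/
def Compatible (inst : Fin n → RealInterval) (H : List (Fin n)) : Prop :=
  ∀ (i j : ℕ) (y z : Fin n), H[i]? = some y → H[j]? = some z →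
    Conflict (inst y) (inst z) → i = j

theorem compatible_nil : Compatible inst [] := by
  intro i j y z h
  simp at h

/-- A replacing interval lies inside the one it replaces, so it meets nothing else that is held. -/
theorem Compatible.step {H : List (Fin n)} (hH : Compatible inst H) (x : Fin n) :
    Compatible inst (step inst H x) := by
  rcases step_cases inst H x with ⟨h, hc⟩ | ⟨k, hk, h, hs⟩ | ⟨h, -⟩
  · rw [h]
    intro i j y z hi hj hyz
    rw [List.getElem?_append] at hi hj
    split_ifs at hi hj with h1 h2 h2
    · exact hH i j y z hi hj hyz
    · rw [List.getElem?_singleton] at hj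
      split_ifs at hj with h3
      cases hj
      exact absurd hyz.symm (hc y (List.mem_of_getElem? hi))
    · rw [List.getElem?_singleton] at hi
      split_ifs at hi with h3
      cases hi
      exact absurd hyz (hc z (List.mem_of_getElem? hj))
    · rw [List.getElem?_singleton] at hi hj
      split_ifs at hi hj with h3 h4
      omega
  · rw [h]
    have hk' : H[k]? = some H[k] := List.getElem?_eq_getElem hk
    intro i j y z hi hj hyz
    rw [List.getElem?_set] at hi hj
    split_ifs at hi hj with h1 h2 h2
    · omega
    · cases hi
      rw [← h1]
      exact (hH j k z _ hj hk' (hyz.symm.mono hs)).symm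
    · cases hj
      rw [← h2]
      exact hH i k y _ hi hk' (hyz.mono hs)
    · exact hH i j y z hi hj hyz
  · rw [h]
    exact hH

theorem length_le_length_step (H : List (Fin n)) (x : Fin n) :
    H.length ≤ (step inst H x).length := by
  rcases step_cases inst H x with ⟨h, -⟩ | ⟨k, hk, h, -⟩ | ⟨h, -⟩ <;> simp [h]

theorem length_le_length_foldl (H l : List (Fin n)) :
    H.length ≤ (l.foldl (step inst) H).length := by
  induction l generalizing H with
  | nil => exact le_rfl
  | cons x l ih => exact (length_le_length_step H x).trans (ih _)

theorem length_foldl_le (H l : List (Fin n)) :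
    (l.foldl (step inst) H).length ≤ H.length + l.length := by
  induction l generalizing H with
  | nil => simp
  | cons x l ih =>
    refine (ih _).trans ?_
    rcases step_cases inst H x with ⟨h, -⟩ | ⟨k, hk, h, -⟩ | ⟨h, -⟩ <;>
      (simp [h]; try omega)

open Classical in
/-- The item that occupies the place of `y` after the arrival of `x`. -/
noncomputable def successor (inst : Fin n → RealInterval) (y x : Fin n) : Fin n :=
  if Subsumed (inst x) (inst y) then x else y

theorem Conflict.of_successor {I : RealInterval} {x y : Fin n}
    (h : Conflict I (inst (successor inst y x))) : Conflict I (inst y) := by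
  unfold successor at h
  split_ifs at h with hs
  · exact h.mono hs
  · exact h

/-- An occupied place evolves independently of the other places. -/
theorem getElem?_step {H : List (Fin n)} (hH : Compatible inst H) {i : ℕ} {y : Fin n}
    (hy : H[i]? = some y) (x : Fin n) :
    (step inst H x)[i]? = some (successor inst y x) := by
  have hi : i < H.length := (List.getElem?_eq_some_iff.1 hy).1
  have hmem : y ∈ H := List.mem_of_getElem? hy
  rcases step_cases inst H x with ⟨h, hc⟩ | ⟨k, hk, h, hs⟩ | ⟨h, -, hs⟩
  · rw [h, List.getElem?_append_left hi, hy, successor,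
      if_neg fun hs => hc y hmem hs.conflict]
  · have hk' : H[k]? = some H[k] := List.getElem?_eq_getElem hk
    rw [h, List.getElem?_set]
    split_ifs with h1
    · subst h1
      rw [hy] at hk'
      cases hk'
      rw [successor, if_pos hs]
    · rw [hy, successor, if_neg]
      intro hs'
      -- If `x` lay in two held intervals, these would meet.
      exact h1 (hH k i _ y hk' hy ((hs.conflict.symm).mono hs'))
  · rw [h, hy, successor, if_neg (hs y hmem)]

/-- After the arrival of `x`, some held item conflicts with `x` (or is `x` itself). -/
theorem exists_conflict_step (inst : Fin n → RealInterval) (H : List (Fin n)) (x : Fin n) :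
    ∃ (i : ℕ) (y : Fin n), (step inst H x)[i]? = some y ∧ Conflict (inst x) (inst y) := by
  rcases step_cases inst H x with ⟨h, -⟩ | ⟨k, hk, h, -⟩ | ⟨h, ⟨y, hy, hxy⟩, -⟩
  · exact ⟨H.length, x, by simp [h], conflict_self _⟩
  · exact ⟨k, x, by simp [h, hk], conflict_self _⟩
  · obtain ⟨i, hi⟩ := List.mem_iff_getElem?.1 hy
    exact ⟨i, y, by rw [h, hi], hxy⟩

end Step

/-! ### Expected charge of an opened place. -/

section Trace

variable {n : ℕ} {inst : Fin n → RealInterval} {O : Finset (Fin n)}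

open Classical in
/-- The number of members of `O` that, on arriving in the order `l`, conflict with the item then
occupying the place that is initially occupied by `y`. -/
noncomputable def traceCharge (inst : Fin n → RealInterval) (O : Finset (Fin n)) :
    Fin n → List (Fin n) → ℕ
  | _, [] => 0
  | y, x :: l =>
    (if x ∈ O ∧ Conflict (inst x) (inst (successor inst y x)) then 1 else 0) +
      traceCharge inst O (successor inst y x) l

/-- The expectation of `traceCharge` when the items of `A` arrive in random order. -/
noncomputable def meanTraceCharge (inst : Fin n → RealInterval) (O : Finset (Fin n)) (y : Fin n)
    (A : Finset (Fin n)) : ℝ :=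
  𝔼 l ∈ orders A, (traceCharge inst O y l : ℝ)

open Classical in
/-- The members of `O` in `A` that are strictly contained in `y`. -/
noncomputable def innerItems (inst : Fin n → RealInterval) (O A : Finset (Fin n)) (y : Fin n) :
    Finset (Fin n) :=
  {x ∈ A | x ∈ O ∧ Subsumed (inst x) (inst y)}

open Classical in
/-- The members of `O` in `A` that conflict with `y` and are not strictly contained in it. -/
noncomputable def outerItems (inst : Fin n → RealInterval) (O A : Finset (Fin n)) (y : Fin n) :
    Finset (Fin n) :=
  {x ∈ A | x ∈ O ∧ Conflict (inst x) (inst y) ∧ ¬ Subsumed (inst x) (inst y)}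

open Classical in
theorem card_filter_conflict (A : Finset (Fin n)) (y : Fin n) :
    (A.filter fun x => x ∈ O ∧ Conflict (inst x) (inst y)).card =
      (outerItems inst O A y).card + (innerItems inst O A y).card := by
  rw [← Finset.card_filter_add_card_filter_not (s := A.filter _)
    fun x => ¬ Subsumed (inst x) (inst y), Finset.filter_filter, Finset.filter_filter]
  congr 2
  · ext x
    simp only [outerItems, Finset.mem_filter]
    tauto
  · ext x
    simp only [innerItems, Finset.mem_filter, not_not]
    exact and_congr_right fun _ => ⟨fun h => ⟨h.1.1, h.2⟩, fun h => ⟨⟨h.1, h.2.conflict⟩, h.2⟩⟩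

-- Successive holders of a place shrink, so whatever meets a later holder already meets `y`.
open Classical in
theorem traceCharge_le (y : Fin n) (l : List (Fin n)) :
    traceCharge inst O y l ≤ l.countP fun x => x ∈ O ∧ Conflict (inst x) (inst y) := by
  induction l generalizing y with
  | nil => simp [traceCharge]
  | cons x l ih =>
    rw [traceCharge, List.countP_cons, add_comm]
    refine Nat.add_le_add ((ih _).trans (List.countP_mono_left fun z _ hz => ?_)) ?_
    · simp only [decide_eq_true_eq] at hz ⊢
      exact ⟨hz.1, Conflict.of_successor hz.2⟩
    · split_ifs with h1 h2 h2
      · exact le_rfl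
      · simp only [decide_eq_true_eq] at h2
        exact absurd ⟨h1.1, Conflict.of_successor h1.2⟩ h2
      · exact Nat.zero_le _
      · exact le_rfl

theorem meanTraceCharge_le_card (y : Fin n) (A : Finset (Fin n)) :
    meanTraceCharge inst O y A ≤ (outerItems inst O A y).card + (innerItems inst O A y).card := by
  classical
  rw [← Nat.cast_add, ← card_filter_conflict]
  refine (Finset.expect_le_expect (g := fun _ => _) fun l hl => ?_).trans
    (Finset.expect_const (orders_nonempty A) _).le
  obtain ⟨h1, h2⟩ := mem_orders.1 hl
  refine Nat.cast_le.2 ((traceCharge_le y l).trans ?_)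
  rw [List.countP_eq_length_filter,
    ← List.toFinset_card_of_nodup (h1.filter _)]
  refine Finset.card_le_card fun x hx => ?_
  simp only [List.mem_toFinset, List.mem_filter, decide_eq_true_eq] at hx
  exact Finset.mem_filter.2 ⟨(h2 x).1 hx.1, hx.2⟩

open Classical in
theorem meanTraceCharge_eq (y : Fin n) {A : Finset (Fin n)} (hA : A.Nonempty) :
    meanTraceCharge inst O y A =
      𝔼 x ∈ A, ((if x ∈ O ∧ Conflict (inst x) (inst (successor inst y x)) then 1 else 0) +
        meanTraceCharge inst O (successor inst y x) (A.erase x)) := by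
  unfold meanTraceCharge
  rw [expect_orders hA]
  refine Finset.expect_congr rfl fun x _ => ?_
  simp only [traceCharge]
  push_cast
  rw [Finset.expect_add_distrib, Finset.expect_const (orders_nonempty _)]

/-- Once a member of `O` occupies a place, no other member of `O` is charged to it. -/
theorem meanTraceCharge_erase_self (hO : Feasible inst O) {x : Fin n} (hx : x ∈ O)
    (A : Finset (Fin n)) : meanTraceCharge inst O x (A.erase x) ≤ 0 := by
  classical
  refine (meanTraceCharge_le_card x _).trans ?_
  rw [← Nat.cast_add, ← card_filter_conflict, Finset.filter_eq_empty_iff.2]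
  · simp
  · rintro z hz ⟨hzO, hc⟩
    exact hO z hzO x hx (Finset.ne_of_mem_erase hz) hc

theorem _root_.RealInterval.conflict_iff {I J : RealInterval} :
    Conflict I J ↔ I.start < J.finish ∧ J.start < I.finish := by
  constructor
  · rintro ⟨x, ⟨h1, h2⟩, h3, h4⟩
    exact ⟨h1.trans_lt h4, h3.trans_lt h2⟩
  · rintro ⟨h1, h2⟩
    exact ⟨max I.start J.start, ⟨le_max_left _ _, max_lt I.start_lt_finish h2⟩,
      le_max_right _ _, max_lt h1 J.start_lt_finish⟩

/-- The first alternative is weak so as to cover equal intervals, which are not strictly contained.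
-/
theorem _root_.RealInterval.start_le_or_finish_lt {I J : RealInterval}
    (h : ¬ Subsumed I J) : I.start ≤ J.start ∨ J.finish < I.finish := by
  by_contra hc
  push Not at hc
  refine h ⟨Set.Ico_subset_Ico hc.1.le hc.2, fun hs => ?_⟩
  exact absurd (hs ⟨le_rfl, J.start_lt_finish⟩).1 (not_le.2 hc.1)

/-- Outer items starting no later than `y` all contain its starting point; the others all contain
its end point. Feasibility leaves at most one of each kind. -/
theorem card_outerItems_le (hO : Feasible inst O) (A : Finset (Fin n)) (y : Fin n) :
    (outerItems inst O A y).card ≤ 2 := by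
  classical
  have key : ∀ (p : Fin n → Prop) [DecidablePred p], (∀ a b, a ∈ outerItems inst O A y → b ∈ outerItems inst O A y →
      p a → p b → Conflict (inst a) (inst b)) → ((outerItems inst O A y).filter p).card ≤ 1 := by
    intro p _ hp
    refine Finset.card_le_one.2 fun a ha b hb => ?_
    rw [Finset.mem_filter] at ha hb
    by_contra hab
    exact hO a (Finset.mem_filter.1 ha.1).2.1 b (Finset.mem_filter.1 hb.1).2.1 hab
      (hp a b ha.1 hb.1 ha.2 hb.2)
  rw [← Finset.card_filter_add_card_filter_not fun x => (inst x).start ≤ (inst y).start]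
  refine Nat.add_le_add (b := 1) (d := 1) (key _ fun a b ha hb h1 h2 => ?_)
    (key _ fun a b ha hb h1 h2 => ?_)
  · obtain ⟨-, -, hca, -⟩ := Finset.mem_filter.1 ha
    obtain ⟨-, -, hcb, -⟩ := Finset.mem_filter.1 hb
    rw [conflict_iff] at hca hcb ⊢
    exact ⟨h1.trans_lt hcb.2, h2.trans_lt hca.2⟩
  · obtain ⟨-, -, hca, hsa⟩ := Finset.mem_filter.1 ha
    obtain ⟨-, -, hcb, hsb⟩ := Finset.mem_filter.1 hb
    have ha' := (start_le_or_finish_lt hsa).resolve_left h1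
    have hb' := (start_le_or_finish_lt hsb).resolve_left h2
    rw [conflict_iff] at hca hcb ⊢
    exact ⟨hca.1.trans hb', hcb.1.trans ha'⟩

theorem card_outerItems_erase {A : Finset (Fin n)} {x y : Fin n} (hx : x ∈ outerItems inst O A y) :
    (outerItems inst O (A.erase x) y).card + 1 = (outerItems inst O A y).card := by
  rw [← Finset.card_erase_add_one hx, outerItems, outerItems, Finset.filter_erase]

theorem innerItems_erase_subset (A : Finset (Fin n)) (x y : Fin n) :
    innerItems inst O (A.erase x) y ⊆ innerItems inst O A y := by
  classical
  exact Finset.filter_subset_filter _ (Finset.erase_subset _ _)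

/-- The expected charge of a place after it was opened is at most `5 / 2`. -/
theorem meanTraceCharge_le (hO : Feasible inst O) (y : Fin n) (A : Finset (Fin n)) :
    meanTraceCharge inst O y A ≤ 5 / 2 := by
  classical
  induction hk : A.card generalizing y A with
  | zero =>
    refine (meanTraceCharge_le_card y A).trans ?_
    rw [Finset.card_eq_zero.1 hk]
    simp [outerItems, innerItems]
    norm_num
  | succ k ih =>
    have hA : A.Nonempty := Finset.card_pos.1 (by omega)
    have hr := card_outerItems_le hO A y
    set r := (outerItems inst O A y).card with hr_def
    set m := (innerItems inst O A y).card with hm_def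
    have htriv : meanTraceCharge inst O y A ≤ r + m := meanTraceCharge_le_card y A
    by_cases hrm : r + m ≤ 2
    · have : (r + m : ℝ) ≤ 2 := by exact_mod_cast hrm
      linarith
    -- Deviation from 5/2 by type of first arrival: an inner item totals 1, that is, 5/2 - 3/2; an
    -- outer item totals at most 1 plus the smaller of the inductive and the trivial bound.
    have hstep : ∀ x ∈ A,
        ((if x ∈ O ∧ Conflict (inst x) (inst (successor inst y x)) then 1 else 0) +
          meanTraceCharge inst O (successor inst y x) (A.erase x)) ≤
        5 / 2 + (if x ∈ outerItems inst O A y then min (5 / 2) (r + m - 1 : ℝ) - 3 / 2 else 0) -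
          (if x ∈ innerItems inst O A y then (3 / 2 : ℝ) else 0) := by
      intro x hx
      have hcard : (A.erase x).card = k := by
        rw [Finset.card_erase_of_mem hx, hk, Nat.add_sub_cancel]
      have hih : ∀ z, meanTraceCharge inst O z (A.erase x) ≤ 5 / 2 := fun z => ih z _ hcard
      by_cases hs : Subsumed (inst x) (inst y)
      · have hout : x ∉ outerItems inst O A y := fun h => (Finset.mem_filter.1 h).2.2.2 hs
        rw [if_neg hout, successor, if_pos hs]
        by_cases hxO : x ∈ O
        · have hin : x ∈ innerItems inst O A y := Finset.mem_filter.2 ⟨hx, hxO, hs⟩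
          rw [if_pos hin, if_pos ⟨hxO, conflict_self _⟩]
          linarith [meanTraceCharge_erase_self hO hxO A]
        · have hin : x ∉ innerItems inst O A y := fun h => hxO (Finset.mem_filter.1 h).2.1
          rw [if_neg hin, if_neg fun h => hxO h.1]
          linarith [hih x]
      · have hin : x ∉ innerItems inst O A y := fun h => hs (Finset.mem_filter.1 h).2.2
        rw [if_neg hin, successor, if_neg hs]
        by_cases hc : x ∈ O ∧ Conflict (inst x) (inst y)
        · have hout : x ∈ outerItems inst O A y := Finset.mem_filter.2 ⟨hx, hc.1, hc.2, hs⟩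
          rw [if_pos hc, if_pos hout]
          have h1 := meanTraceCharge_le_card (inst := inst) (O := O) y (A.erase x)
          have h2 : ((outerItems inst O (A.erase x) y).card : ℝ) + 1 = r := by
            exact_mod_cast card_outerItems_erase hout
          have h3 : ((innerItems inst O (A.erase x) y).card : ℝ) ≤ m :=
            Nat.cast_le.2 (Finset.card_le_card (innerItems_erase_subset A x y))
          have h4 : meanTraceCharge inst O y (A.erase x) ≤ min (5 / 2) (r + m - 1 : ℝ) :=
            le_min (hih y) (by linarith)
          linarith
        · have hout : x ∉ outerItems inst O A y := fun h =>
            hc ⟨(Finset.mem_filter.1 h).2.1, (Finset.mem_filter.1 h).2.2.1⟩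
          rw [if_neg hc, if_neg hout]
          linarith [hih y]
    rw [meanTraceCharge_eq y hA]
    refine (Finset.expect_le_expect hstep).trans ?_
    have hcpos : (0 : ℝ) < A.card := Nat.cast_pos.2 (Finset.card_pos.2 hA)
    rw [Finset.expect_eq_sum_div_card, div_le_iff₀ hcpos, Finset.sum_sub_distrib,
      Finset.sum_add_distrib, ← Finset.sum_filter, ← Finset.sum_filter]
    have hfo : (A.filter fun x => x ∈ outerItems inst O A y) = outerItems inst O A y :=
      Finset.filter_mem_eq_inter.trans
        (Finset.inter_eq_right.2 (Finset.filter_subset _ _))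
    have hfi : (A.filter fun x => x ∈ innerItems inst O A y) = innerItems inst O A y :=
      Finset.filter_mem_eq_inter.trans
        (Finset.inter_eq_right.2 (Finset.filter_subset _ _))
    simp only [hfo, hfi, Finset.sum_const, nsmul_eq_mul, ← hr_def, ← hm_def]
    -- If `r + m = 3`, each outer item exceeds by at most 1/2 and `m ≥ 1`; if `r + m ≥ 4`, by at
    -- most 1 and `m ≥ 2`.
    have hfinal : (r : ℝ) * (min (5 / 2) (r + m - 1 : ℝ) - 3 / 2) ≤ m * (3 / 2) := by
      have hr0 : (0 : ℝ) ≤ r := Nat.cast_nonneg r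
      have hr2 : (r : ℝ) ≤ 2 := by exact_mod_cast hr
      by_cases h3 : r + m = 3
      · have h3' : (r + m : ℝ) = 3 := by exact_mod_cast h3
        have := min_le_right (5 / 2) (r + m - 1 : ℝ)
        nlinarith
      · have h4 : (4 : ℝ) ≤ r + m := by
          have : 4 ≤ r + m := by omega
          exact_mod_cast this
        have := min_le_left (5 / 2) (r + m - 1 : ℝ)
        nlinarith
    linarith

end Trace

/-! ### From single places to the whole solution. -/

section Place

variable {n : ℕ} {inst : Fin n → RealInterval} {O : Finset (Fin n)}

/-- The item `x`, arriving when the solution is `H`, may be charged to the place `i`. -/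
def Chargeable (inst : Fin n → RealInterval) (H : List (Fin n)) (x : Fin n) (i : ℕ) : Prop :=
  ∃ y, (step inst H x)[i]? = some y ∧ Conflict (inst x) (inst y)

open Classical in
/-- The number of members of `O` that may be charged to the place `i` when the items of `l` arrive
and the initial solution is `H`. -/
noncomputable def placeCharge (inst : Fin n → RealInterval) (O : Finset (Fin n)) (i : ℕ) :
    List (Fin n) → List (Fin n) → ℕ
  | _, [] => 0
  | H, x :: l =>
    (if x ∈ O ∧ Chargeable inst H x i then 1 else 0) + placeCharge inst O i (step inst H x) l

theorem placeCharge_eq_traceCharge {H : List (Fin n)} (hH : Compatible inst H) {i : ℕ}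
    {y : Fin n} (hy : H[i]? = some y) (l : List (Fin n)) :
    placeCharge inst O i H l = traceCharge inst O y l := by
  induction l generalizing H y with
  | nil => rfl
  | cons x l ih =>
    have hs := getElem?_step hH hy x
    rw [placeCharge, traceCharge, ih (hH.step x) hs]
    congr 2
    simp [Chargeable, hs]

open Classical in
/-- The expected charge of the place `i` is at most `5 / 2` times the probability that the place is
ever opened. -/
theorem expect_placeCharge_le (hO : Feasible inst O) (i : ℕ) {H : List (Fin n)}
    (hH : Compatible inst H) (A : Finset (Fin n)) :
    𝔼 l ∈ orders A, (placeCharge inst O i H l : ℝ) ≤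
      5 / 2 * 𝔼 l ∈ orders A, if i < (l.foldl (step inst) H).length then (1 : ℝ) else 0 := by
  by_cases hi : i < H.length
  · have h1 : 𝔼 l ∈ orders A, (placeCharge inst O i H l : ℝ) =
        meanTraceCharge inst O H[i] A :=
      Finset.expect_congr rfl fun l _ => by
        rw [placeCharge_eq_traceCharge hH (List.getElem?_eq_getElem hi)]
    have h2 : (𝔼 l ∈ orders A, if i < (l.foldl (step inst) H).length then (1 : ℝ) else 0) = 1 := by
      rw [Finset.expect_congr rfl fun l _ => if_pos (hi.trans_le (length_le_length_foldl H l)),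
        Finset.expect_const (orders_nonempty A)]
    rw [h1, h2, mul_one]
    exact meanTraceCharge_le hO _ A
  induction hk : A.card generalizing H A with
  | zero =>
    rw [Finset.card_eq_zero.1 hk, orders_empty]
    simp [placeCharge, hi]
  | succ k ih =>
    have hA : A.Nonempty := Finset.card_pos.1 (by omega)
    rw [expect_orders hA, expect_orders hA, Finset.mul_expect]
    refine Finset.expect_le_expect fun x hx => ?_
    simp only [placeCharge]
    by_cases hi' : i < (step inst H x).length
    · have hlen : ∀ l, i < ((x :: l).foldl (step inst) H).length := fun l =>
        hi'.trans_le (length_le_length_foldl (step inst H x) l)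
      simp only [hlen, if_true]
      rw [Finset.expect_const (orders_nonempty _), mul_one]
      -- Only an append lengthens the list, so `x` itself has just opened place `i`.
      have hx' : (step inst H x)[i]? = some x := by
        rcases step_cases inst H x with ⟨h, -⟩ | ⟨j, hj, h, -⟩ | ⟨h, -⟩
        · rw [h, List.length_append, List.length_singleton] at hi'
          rw [h, show i = H.length by omega]
          simp
        · rw [h, List.length_set] at hi'
          exact absurd hi' hi
        · rw [h] at hi'
          exact absurd hi' hi
      have hmean : 𝔼 l ∈ orders (A.erase x),
          ((((if x ∈ O ∧ Chargeable inst H x i then 1 else 0) +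
            placeCharge inst O i (step inst H x) l : ℕ)) : ℝ) =
          (if x ∈ O ∧ Chargeable inst H x i then 1 else 0) +
            meanTraceCharge inst O x (A.erase x) := by
        push_cast
        rw [Finset.expect_add_distrib, Finset.expect_const (orders_nonempty _), meanTraceCharge]
        congr 1
        exact Finset.expect_congr rfl fun l _ => by
          rw [placeCharge_eq_traceCharge (hH.step x) hx']
      rw [hmean]
      split_ifs with h
      · linarith [meanTraceCharge_erase_self hO h.1 A]
      · linarith [meanTraceCharge_le hO x (A.erase x)]
    · have hnot : ¬ Chargeable inst H x i := by
        rintro ⟨y, hy, -⟩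
        exact hi' (List.getElem?_eq_some_iff.1 hy).1
      simp only [hnot, and_false, if_false, zero_add]
      exact ih (hH.step x) (A.erase x) hi' (by
        rw [Finset.card_erase_of_mem hx, hk, Nat.add_sub_cancel])

/-- Any assignment of the members of `O` to places that may be charged is dominated by
`placeCharge`. -/
theorem card_filter_le_placeCharge (i : ℕ) (f : Fin n → ℕ) {l : List (Fin n)} (hl : l.Nodup)
    (H : List (Fin n))
    (hf : ∀ l₁ x l₂, l = l₁ ++ x :: l₂ → x ∈ O → f x = i →
      Chargeable inst (l₁.foldl (step inst) H) x i) :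
    (O.filter fun o => o ∈ l ∧ f o = i).card ≤ placeCharge inst O i H l := by
  induction l generalizing H with
  | nil => simp [placeCharge]
  | cons x l ih =>
    rw [List.nodup_cons] at hl
    have h := ih hl.2 (step inst H x) fun l₁ z l₂ h hz hfz => by
      simpa using hf (x :: l₁) z l₂ (by rw [h, List.cons_append]) hz hfz
    rw [placeCharge, add_comm]
    by_cases hx : x ∈ O ∧ f x = i
    · have hc := hf [] x l rfl hx.1 hx.2
      rw [List.foldl_nil] at hc
      rw [if_pos ⟨hx.1, hc⟩]
      refine le_trans ?_ (Nat.add_le_add_right h 1)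
      refine (Finset.card_le_card fun o ho => ?_).trans (Finset.card_insert_le x _)
      rw [Finset.mem_filter, List.mem_cons] at ho
      rw [Finset.mem_insert, Finset.mem_filter]
      tauto
    · refine le_trans (Finset.card_le_card fun o ho => ?_) (h.trans (Nat.le_add_right _ _))
      rw [Finset.mem_filter, List.mem_cons] at ho
      rw [Finset.mem_filter]
      refine ⟨ho.1, ho.2.1.resolve_left ?_, ho.2.2⟩
      rintro rfl
      exact hx ⟨ho.1, ho.2.2⟩

/-- Every member of `O` may be charged to some place. -/
theorem card_filter_le_sum_placeCharge (N : ℕ) {l : List (Fin n)} (hl : l.Nodup)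
    (H : List (Fin n)) (hN : (l.foldl (step inst) H).length ≤ N) :
    (O.filter fun o => o ∈ l).card ≤ ∑ i ∈ Finset.range N, placeCharge inst O i H l := by
  classical
  induction l generalizing H with
  | nil => simp
  | cons x l ih =>
    rw [List.nodup_cons] at hl
    have h := ih hl.2 (step inst H x) hN
    simp only [placeCharge]
    rw [Finset.sum_add_distrib, add_comm]
    by_cases hx : x ∈ O
    · obtain ⟨i, y, hi, hxy⟩ := exists_conflict_step inst H x
      have hiN : i ∈ Finset.range N :=
        Finset.mem_range.2 (((List.getElem?_eq_some_iff.1 hi).1.trans_le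
          (length_le_length_foldl (step inst H x) l)).trans_le hN)
      have h1 : 1 ≤ ∑ i ∈ Finset.range N, if x ∈ O ∧ Chargeable inst H x i then 1 else 0 := by
        refine le_trans ?_ (Finset.single_le_sum (fun _ _ => Nat.zero_le _) hiN)
        rw [if_pos ⟨hx, y, hi, hxy⟩]
      refine le_trans ?_ (Nat.add_le_add h h1)
      refine (Finset.card_le_card fun o ho => ?_).trans (Finset.card_insert_le x _)
      rw [Finset.mem_filter, List.mem_cons] at ho
      rw [Finset.mem_insert, Finset.mem_filter]
      tauto
    · refine le_trans (Finset.card_le_card fun o ho => ?_) (h.trans (Nat.le_add_right _ _))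
      rw [Finset.mem_filter, List.mem_cons] at ho
      rw [Finset.mem_filter]
      refine ⟨ho.1, ho.2.resolve_left ?_⟩
      rintro rfl
      exact hx ho.1

theorem algSolution_eq_foldl (σ : Equiv.Perm (Fin n)) :
    algSolution inst σ = (List.ofFn σ).foldl (step inst) [] := by
  rw [algSolution, solutionAt, List.take_of_length_le (by simp)]

theorem mem_ofFn_perm (σ : Equiv.Perm (Fin n)) (x : Fin n) : x ∈ List.ofFn σ := by
  simpa [List.mem_ofFn] using σ.surjective x

theorem expect_perm_placeCharge_le (hO : Feasible inst O) (i : ℕ) :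
    𝔼 σ : Equiv.Perm (Fin n), (placeCharge inst O i [] (List.ofFn σ) : ℝ) ≤
      5 / 2 * 𝔼 σ : Equiv.Perm (Fin n),
        if i < (algSolution inst σ).length then (1 : ℝ) else 0 := by
  classical
  simp only [algSolution_eq_foldl]
  rw [expect_perm fun l => (placeCharge inst O i [] l : ℝ),
    expect_perm fun l => if i < (l.foldl (step inst) []).length then (1 : ℝ) else 0]
  convert expect_placeCharge_le hO i compatible_nil Finset.univ

theorem IsCharging.charge_le {σ : Equiv.Perm (Fin n)} {f : Fin n → ℕ}
    (hf : IsCharging inst O σ f) (i : ℕ) :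
    charge O f i ≤ placeCharge inst O i [] (List.ofFn σ) := by
  have hnd : (List.ofFn σ).Nodup := List.nodup_ofFn.2 σ.injective
  have h := card_filter_le_placeCharge (inst := inst) (O := O) i f hnd [] ?_
  · simpa [charge, mem_ofFn_perm] using h
  rintro l₁ x l₂ hl hx rfl
  have hlen : l₁.length < n := by
    have := congrArg List.length hl
    simp at this
    omega
  have hxt : σ ⟨l₁.length, hlen⟩ = x := by
    have h1 : (List.ofFn σ)[l₁.length]? = some x := by rw [hl]; simp
    rw [List.getElem?_ofFn, dif_pos hlen] at h1
    exact Option.some.inj h1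
  have h0 : solutionAt inst σ l₁.length = l₁.foldl (step inst) [] := by
    rw [solutionAt, hl, List.take_left']
    rfl
  have h1 : solutionAt inst σ (l₁.length + 1) = step inst (l₁.foldl (step inst) []) x := by
    rw [solutionAt, hl, List.take_length_add_append]
    simp
  have hch := hf ⟨l₁.length, hlen⟩
  rw [hxt] at hch
  dsimp only at hch
  rw [h0, h1] at hch
  obtain ⟨ha, hb⟩ := hch hx
  -- A taken item stands at the place it is charged to; a rejected one leaves the list unchanged, so
  -- the item it is charged to is still there after the step.
  by_cases hmem : x ∈ step inst (l₁.foldl (step inst) []) x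
  · exact ⟨x, ha hmem, conflict_self _⟩
  · obtain ⟨y, hy, hxy⟩ := hb hmem
    refine ⟨y, ?_, hxy⟩
    rcases step_cases inst (l₁.foldl (step inst) []) x with ⟨h, -⟩ | ⟨j, hj, h, -⟩ | ⟨h, -⟩
    · simp [h] at hmem
    · rw [h] at hmem
      exact absurd (List.mem_set hj x) hmem
    · rw [h, hy]

theorem expect_charge_le (hO : Feasible inst O) {F : Equiv.Perm (Fin n) → Fin n → ℕ}
    (hF : ∀ σ, IsCharging inst O σ (F σ)) (i : ℕ) :
    (𝔼 σ : Equiv.Perm (Fin n) with i < (algSolution inst σ).length, (charge O (F σ) i : ℝ)) ≤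
      5 / 2 := by
  classical
  have h := expect_perm_placeCharge_le hO i
  rw [Finset.expect_eq_sum_div_card, Finset.expect_eq_sum_div_card, ← mul_div_assoc,
    div_le_div_iff_of_pos_right (Nat.cast_pos.2 (Finset.card_pos.2 Finset.univ_nonempty)),
    Finset.sum_boole] at h
  rw [Finset.expect_eq_sum_div_card]
  -- If place `i` is never opened, the quotient is `0` by convention; this form of division covers
  -- that case.
  refine div_le_of_le_mul₀ (Nat.cast_nonneg _) (by norm_num) (le_trans ?_ h)
  refine (Finset.sum_le_sum fun σ _ => Nat.cast_le.2 ((hF σ).charge_le i)).trans ?_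
  exact Finset.sum_le_sum_of_subset_of_nonneg (Finset.filter_subset _ _)
    fun _ _ _ => Nat.cast_nonneg _

theorem card_le_expect_length (hO : Feasible inst O) :
    (O.card : ℝ) ≤ 5 / 2 * 𝔼 σ : Equiv.Perm (Fin n), ((algSolution inst σ).length : ℝ) := by
  classical
  have hlen : ∀ σ : Equiv.Perm (Fin n), (algSolution inst σ).length ≤ n := fun σ => by
    rw [algSolution_eq_foldl]
    simpa using length_foldl_le (inst := inst) [] (List.ofFn σ)
  have h1 : (O.card : ℝ) ≤ 𝔼 σ : Equiv.Perm (Fin n),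
      ∑ i ∈ Finset.range n, (placeCharge inst O i [] (List.ofFn σ) : ℝ) := by
    rw [← Finset.expect_const (Finset.univ_nonempty (α := Equiv.Perm (Fin n))) (O.card : ℝ)]
    refine Finset.expect_le_expect fun σ _ => ?_
    have h := card_filter_le_sum_placeCharge (inst := inst) (O := O) n
      (List.nodup_ofFn.2 σ.injective) [] (by rw [← algSolution_eq_foldl]; exact hlen σ)
    simp only [mem_ofFn_perm, Finset.filter_true] at h
    exact_mod_cast h
  -- The final size is the number of opened places, so its mean is the sum of their opening
  -- probabilities.
  have h2 : ∀ σ : Equiv.Perm (Fin n), ((algSolution inst σ).length : ℝ) =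
      ∑ i ∈ Finset.range n, if i < (algSolution inst σ).length then (1 : ℝ) else 0 := fun σ => by
    rw [Finset.sum_boole, ← Finset.card_range (algSolution inst σ).length]
    congr 2
    ext i
    have := hlen σ
    simp
    omega
  refine h1.trans ?_
  rw [Finset.expect_congr rfl fun σ _ => h2 σ, Finset.expect_sum_comm, Finset.expect_sum_comm,
    Finset.mul_sum]
  exact Finset.sum_le_sum fun i _ => expect_perm_placeCharge_le hO i

theorem exists_feasible_card_eq_optSize (inst : Fin n → RealInterval) :
    ∃ O, Feasible inst O ∧ O.card = optSize inst := by
  classical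
  have hne : (Finset.univ.filter fun O : Finset (Fin n) => Feasible inst O).Nonempty :=
    ⟨∅, Finset.mem_filter.2 ⟨Finset.mem_univ _, by simp [Feasible]⟩⟩
  obtain ⟨O, hO, h⟩ := Finset.exists_mem_eq_sup _ hne Finset.card
  refine ⟨O, (Finset.mem_filter.1 hO).2, ?_⟩
  rw [optSize, ← h]

end Place

end IntervalSelection

theorem mainTheorem1 {n : ℕ} (inst : Fin n → RealInterval) :
    -- the algorithm is 2.5-competitive under uniformly random arrivals
    ((IntervalSelection.optSize inst : ℝ) ≤
      5 / 2 * 𝔼 σ : Equiv.Perm (Fin n),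
        ((IntervalSelection.algSolution inst σ).length : ℝ)) ∧
    -- the interval ending the `i`-th predecessor trace has expected charge at most 2.5,
    -- conditionally on there being such an interval in the final solution
    (∀ O : Finset (Fin n), IntervalSelection.IsOptimal inst O →
      ∀ F : Equiv.Perm (Fin n) → Fin n → ℕ,
        (∀ σ, IntervalSelection.IsCharging inst O σ (F σ)) →
        ∀ i : ℕ,
          (𝔼 σ : Equiv.Perm (Fin n) with i < (IntervalSelection.algSolution inst σ).length,
            (IntervalSelection.charge O (F σ) i : ℝ)) ≤ 5 / 2) := by
  refine ⟨?_, fun O hO F hF i => IntervalSelection.expect_charge_le hO.1 hF i⟩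
  obtain ⟨O, hO, h⟩ := IntervalSelection.exists_feasible_card_eq_optSize inst
  rw [← h]
  exact IntervalSelection.card_le_expect_length hO
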